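/- **Amplitude amplification requires inverse access.** Let $d=2m$ with $m\ge 2$. An *instance with amplitude $a\in[0,1]$ and good state $|\phi_{\rm good}\rangle\in\mathbb C^{m}$* is a unitary $X\in\mathbb C^{d\times d}$, acting on $\mathbb C^{m}\otimes\mathbb C^{2}$, such that $$X|0\rangle|0\rangle=a\,|\phi_{\rm good}\rangle|0\rangle+\sqrt{1-a^2}\,|\phi_{\rm bad}\rangle|1\rangle$$ for unit vectors $|\phi_{\rm good}\rangle,|\phi_{\rm bad}\rangle\in\mathbb C^m$. A *forward-query algorithm* is an adaptive quantum algorithm that can apply the unknown $X$ but not $X^\dagger$. It starts in a fixed density matrix on a $d$-dimensional query register together with a finite-dimensional workspace. For $k=0,1,2,\dots$, after $k$ applications of $X$, it performs an arbitrary quantum instrument (independent of $X$) with the two outcomes "halt", which yields an output state on $\mathbb C^m$, and "continue", which yields a state on the query register and a new workspace of any finite dimension, and upon which $X$ is applied to the query register. There is no bound on the number of rounds. Its output on $X$ is the mixture $\rho_X$ over all its runs. It *solves amplitude amplification* on an instance if the trace distance satisfies $\frac12\big\|\rho_X-|\phi_{\rm good}\rangle\langle\phi_{\rm good}|\big\|_1\le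 0.01$. There are absolute constants $c>0$ and $K\ge 1$ such that, for every $m\ge 2$ (with $d=2m$), every $a^*\in(0,1]$, and every forward-query algorithm that solves amplitude amplification on all instances with amplitude $a\in[a^*,Ka^*]$, there is an instance $X$ with amplitude $a\in[a^*,Ka^*]$ on which the expected number of applications of $X$ made by the algorithm is at least $$c\cdot\min\!\Big(d,\frac1{(a^*)^2}\Big).$$ In particular, the worst-case number of applications is at least this large, and the bound holds for algorithms that solve amplitude amplification for all $a>0$, or for all $a\ge a^*$. -/

import Mathlib

open scoped Matrix Kronecker ComplexOrder

namespace AmpAmp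

/-- Index set of the computational basis of `ℂ^m ⊗ ℂ^2`, the space of dimension `d = 2 * m` on which
the input unitary acts: the first register has dimension `m`, the second one is the flag qubit. -/
abbrev Reg (m : ℕ) : Type := Fin m × Fin 2

/-- A pure quantum state: a vector of Euclidean norm one. -/
def IsPureState {ι : Type*} [Fintype ι] (v : ι → ℂ) : Prop :=
  ∑ i, ‖v i‖ ^ 2 = 1

/-- The rank-one operator `|φ⟩⟨φ|`. -/
def proj {ι : Type*} (φ : ι → ℂ) : Matrix ι ι ℂ :=
  Matrix.vecMulVec φ (star φ)

/-- `X` is a unitary matrix on `ℂ^m ⊗ ℂ^2` such that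
`X |0⟩|0⟩ = a |φ⟩|0⟩ + √(1 - a²) |φ_bad⟩|1⟩`, where `φ` and some `φ_bad` are pure states and
`0 ≤ a ≤ 1`. -/
def IsInstance {m : ℕ} [NeZero m] (X : Matrix (Reg m) (Reg m) ℂ) (a : ℝ) (φ : Fin m → ℂ) : Prop :=
  X ∈ Matrix.unitaryGroup (Reg m) ℂ ∧ 0 ≤ a ∧ a ≤ 1 ∧ IsPureState φ ∧
    ∃ φbad : Fin m → ℂ, IsPureState φbad ∧
      ∀ i : Fin m,
        X (i, 0) (0, 0) = (a : ℂ) * φ i ∧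
        X (i, 1) (0, 0) = (Real.sqrt (1 - a ^ 2) : ℂ) * φbad i

/-- The trace norm: the sum of the singular values. -/
noncomputable def traceNorm {m : ℕ} (A : Matrix (Fin m) (Fin m) ℂ) : ℝ :=
  ∑ i ∈ Finset.range m, (Matrix.toEuclideanLin A).singularValues i

/-- The trace distance `½ ‖ρ - σ‖₁`. -/
noncomputable def traceDist {m : ℕ} (ρ σ : Matrix (Fin m) (Fin m) ℂ) : ℝ :=
  traceNorm (ρ - σ) / 2

/-- The completely positive map `ρ ↦ ∑ⱼ Kⱼ ρ Kⱼᴴ` with the Kraus operators `Kⱼ`. -/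
noncomputable def krausMap {ι κ : Type*} [Fintype ι] {r : ℕ}
    (K : Fin r → Matrix κ ι ℂ) (ρ : Matrix ι ι ℂ) : Matrix κ κ ℂ :=
  ∑ j, K j * ρ * (K j)ᴴ

/-- An adaptive quantum algorithm with forward query access to a unitary `X` on `ℂ^m ⊗ ℂ^2`, which
outputs a state on `ℂ^m`. Its memory at stage `k` (after `k` applications of `X`) is the query
register together with a workspace of arbitrary finite dimension `work k`; classical information,
such as former measurement outcomes, is a part of the workspace. At stage `k` the algorithm performs
an arbitrary quantum instrument with two classical outcomes: "halt", with Kraus operators `halt k`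
whose result is the output state, and "continue", with Kraus operators `cont k`, after which `X` is
applied to the query register and stage `k + 1` begins. Nothing bounds the number of stages, and
nothing but the applications of `X` depends on `X`. -/
structure ForwardAlgorithm (m : ℕ) where
  /-- Dimension of the workspace at stage `k`. -/
  work : ℕ → ℕ
  /-- The density matrix in which the memory is initialized. -/
  init : Matrix (Reg m × Fin (work 0)) (Reg m × Fin (work 0)) ℂ
  init_posSemidef : init.PosSemidef
  init_trace : init.trace = 1
  /-- The number of Kraus operators of the outcome "halt" at stage `k`. -/
  haltCount : ℕ → ℕ
  halt : (k : ℕ) → Fin (haltCount k) → Matrix (Fin m) (Reg m × Fin (work k)) ℂ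
  /-- The number of Kraus operators of the outcome "continue" at stage `k`. -/
  contCount : ℕ → ℕ
  cont : (k : ℕ) → Fin (contCount k) →
    Matrix (Reg m × Fin (work (k + 1))) (Reg m × Fin (work k)) ℂ
  complete : ∀ k : ℕ,
    ∑ j, (halt k j)ᴴ * halt k j + ∑ j, (cont k j)ᴴ * cont k j = 1

namespace ForwardAlgorithm

variable {m : ℕ} (A : ForwardAlgorithm m) (X : Matrix (Reg m) (Reg m) ℂ)

/-- The unnormalized state of the memory at the beginning of stage `k`, when the algorithm is run on
`X`; its trace is the probability that stage `k` is reached. -/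
noncomputable def stateAt : (k : ℕ) → Matrix (Reg m × Fin (A.work k)) (Reg m × Fin (A.work k)) ℂ
  | 0 => A.init
  | k + 1 =>
    (X ⊗ₖ (1 : Matrix (Fin (A.work (k + 1))) (Fin (A.work (k + 1))) ℂ)) *
      krausMap (A.cont k) (stateAt k) *
      (X ⊗ₖ (1 : Matrix (Fin (A.work (k + 1))) (Fin (A.work (k + 1))) ℂ))ᴴ

/-- The unnormalized state that the algorithm outputs at stage `k`, when it is run on `X`; its trace
is the probability that the algorithm halts after exactly `k` applications of `X`. -/
noncomputable def outputAt (k : ℕ) : Matrix (Fin m) (Fin m) ℂ :=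
  krausMap (A.halt k) (A.stateAt X k)

/-- Run on `X`, the algorithm outputs the state `ρ` (the mixture over all its possible runs). -/
def Outputs (ρ : Matrix (Fin m) (Fin m) ℂ) : Prop :=
  HasSum (fun k => A.outputAt X k) ρ

/-- The expected number of applications of `X`, namely `∑ₖ P(X is applied at least k + 1 times)`;
it may be infinite. -/
noncomputable def expectedQueries : ENNReal :=
  ∑' k : ℕ, ENNReal.ofReal (A.stateAt X (k + 1)).trace.re

/-- The algorithm solves amplitude amplification for all inputs with amplitude in `[lo, hi]`: it
outputs a state that is `0.01`-close to the good state in trace distance. -/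
def SolvesOn [NeZero m] (lo hi : ℝ) : Prop :=
  ∀ (X : Matrix (Reg m) (Reg m) ℂ) (a : ℝ) (φ : Fin m → ℂ),
    IsInstance X a φ → lo ≤ a → a ≤ hi →
      ∃ ρ : Matrix (Fin m) (Fin m) ℂ, A.Outputs X ρ ∧ traceDist ρ (proj φ) ≤ 0.01

end ForwardAlgorithm

end AmpAmp

/-!
Without access to `Xᴴ`, an algorithm that applies a unitary with randomized rows finds a good state
hidden in one row only incoherently: each query hits that row with probability about `a²`, and these
probabilities add up, while the amplitudes do not.

The hard instances are `X = D * V`. Here `V` arises from one fixed unitary `F` by a permutation of its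
rows that preserves its column `(0, 0)`, and `D` is a diagonal matrix of random phases. This column
has `M ≈ min (m, 1 / a²)` entries `a`, one of which is in the row `(0, 0)`, while all other rows
`(i, 0)` have the entry `0`. So the good state is `|0⟩`; after an exchange of the rows `(0, 0)` and
`(1, 0)` it is `|1⟩`.

Along a fixed sequence of Kraus operators, the state is a polynomial in the phases. Its coefficient
`cvec` at `c` is the part of the state in which every query output `y` occurred `c y` times. Since
only `X` and not `Xᴴ` is applied, counts only grow, so this coefficient depends only on the rows of
`V` that are recorded in `c` (`cvec_congr`). This has two consequences. First, the coefficients in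
which neither `(0, 0)` nor `(1, 0)` is recorded are the same for both good states. Averaging over the
phases removes the interference between different `c` (`sum_norm_sq_phaseChar`), so an algorithm
that is correct for both good states halts with small weight in this sector
(`sum_haltWeight_le`). Secondly, the row `(0, 0)`, as long as it is not recorded, is exchangeable
with every other unrecorded row that has the same entry in the column `(0, 0)`. After `k` queries at
least `M - k` rows are left, so that a query leaves the sector through the row `(0, 0)` with
probability at most `1 / (M - k)`, on average over the permutations (`mul_sum_hitWeight_le`); the
row `(1, 0)` is treated in the same way. If the expected number of queries were much smaller than
`M`, the algorithm would thus halt within `M / 8` queries and inside the sector with a weight that is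
bounded below, a contradiction.
-/

namespace AmpAmp

/-! ### Linear algebra -/

theorem sum_norm_sq_mulVec {ι κ : Type*} [Fintype ι] [Fintype κ] (A : Matrix κ ι ℂ) (v : ι → ℂ) :
    ((∑ i, ‖(A *ᵥ v) i‖ ^ 2 : ℝ) : ℂ) = star v ⬝ᵥ ((Aᴴ * A) *ᵥ v) := by
  rw [← Matrix.mulVec_mulVec, Matrix.dotProduct_mulVec, ← Matrix.star_mulVec]
  push_cast
  simp only [dotProduct, Pi.star_apply, RCLike.star_def, Complex.conj_mul']

theorem sum_norm_sq_eq_dotProduct {ι : Type*} [Fintype ι] (v : ι → ℂ) :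
    ((∑ i, ‖v i‖ ^ 2 : ℝ) : ℂ) = star v ⬝ᵥ v := by
  push_cast
  simp only [dotProduct, Pi.star_apply, RCLike.star_def, Complex.conj_mul']

theorem sum_norm_sq_unitary {ι : Type*} [Fintype ι] [DecidableEq ι] {V : Matrix ι ι ℂ}
    (hV : V ∈ Matrix.unitaryGroup ι ℂ) (u : ι → ℂ) :
    ∑ y, ‖∑ x, V y x * u x‖ ^ 2 = ∑ x, ‖u x‖ ^ 2 := by
  have h := sum_norm_sq_mulVec V u
  have hV' : Vᴴ * V = 1 := Matrix.mem_unitaryGroup_iff'.1 hV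
  rw [hV', Matrix.one_mulVec, ← sum_norm_sq_eq_dotProduct] at h
  exact_mod_cast h

theorem trace_vecMulVec_star_self {ι : Type*} [Fintype ι] (v : ι → ℂ) :
    (Matrix.vecMulVec v (star v)).trace = ((∑ i, ‖v i‖ ^ 2 : ℝ) : ℂ) := by
  rw [sum_norm_sq_eq_dotProduct, Matrix.trace_vecMulVec, dotProduct_comm]

theorem conj_vecMulVec_star_self {ι κ : Type*} [Fintype ι] (K : Matrix κ ι ℂ)
    (v : ι → ℂ) :
    K * Matrix.vecMulVec v (star v) * Kᴴ = Matrix.vecMulVec (K *ᵥ v) (star (K *ᵥ v)) := by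
  rw [Matrix.mul_vecMulVec, Matrix.vecMulVec_mul, Matrix.star_mulVec]

theorem vecMulVec_star_self_diag {ι : Type*} (v : ι → ℂ) (i : ι) :
    Matrix.vecMulVec v (star v) i i = ((‖v i‖ ^ 2 : ℝ) : ℂ) := by
  simp [Matrix.vecMulVec_apply, Complex.mul_conj']

theorem krausMap_sum_vecMulVec {ι κ τ : Type*} [Fintype ι] [Fintype τ] {r : ℕ}
    (K : Fin r → Matrix κ ι ℂ) (v : τ → ι → ℂ) :
    krausMap K (∑ p, Matrix.vecMulVec (v p) (star (v p))) =
      ∑ q : τ × Fin r, Matrix.vecMulVec (K q.2 *ᵥ v q.1) (star (K q.2 *ᵥ v q.1)) := by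
  rw [krausMap, Fintype.sum_prod_type_right]
  refine Finset.sum_congr rfl fun j _ => ?_
  rw [Matrix.mul_sum, Matrix.sum_mul]
  exact Finset.sum_congr rfl fun p _ => conj_vecMulVec_star_self _ _

/-- Every diagonal entry is bounded by the trace norm. -/
theorem norm_diag_le_traceNorm {m : ℕ} (A : Matrix (Fin m) (Fin m) ℂ) (i : Fin m) :
    ‖A i i‖ ≤ traceNorm A := by
  set T := Matrix.toEuclideanLin A with hT
  set e : EuclideanSpace ℂ (Fin m) := EuclideanSpace.single i 1 with he
  have hfin : Module.finrank ℂ (EuclideanSpace ℂ (Fin m)) = m := by simp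
  have hs := T.isSymmetric_adjoint_comp_self
  set b := hs.eigenvectorBasis hfin with hb
  set s : Fin m → ℝ := fun j => T.singularValues j with hsdef
  have hs0 : ∀ j, 0 ≤ s j := fun j => T.singularValues_nonneg j
  have htn : traceNorm A = ∑ j, s j := by
    rw [traceNorm, Finset.sum_range]
  have h1 : ‖A i i‖ ≤ ‖T e‖ := by
    have : A i i = (T e) i := by
      simp [hT, he, Matrix.toLpLin_apply]
    rw [this]
    exact PiLp.norm_apply_le _ _
  have hb1 : ∀ j, ‖inner ℂ (b j) e‖ ≤ 1 := fun j => by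
    refine (norm_inner_le_norm _ _).trans ?_
    simp [he]
  have h2 : ‖T e‖ ^ 2 = ∑ j, s j ^ 2 * ‖inner ℂ (b j) e‖ ^ 2 := by
    have h3 : inner ℂ (T e) (T e) = inner ℂ e ((LinearMap.adjoint T ∘ₗ T) e) := by
      rw [LinearMap.comp_apply, LinearMap.adjoint_inner_right]
    have h4 : inner ℂ e ((LinearMap.adjoint T ∘ₗ T) e)
        = ((∑ j, s j ^ 2 * ‖inner ℂ (b j) e‖ ^ 2 : ℝ) : ℂ) := by
      rw [← b.sum_inner_mul_inner]
      simp only [Complex.ofReal_sum, Complex.ofReal_mul, Complex.ofReal_pow]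
      refine Finset.sum_congr rfl fun j _ => ?_
      rw [← hs (b j) e, hs.apply_eigenvectorBasis hfin j, inner_smul_left,
        ← T.sq_singularValues_fin hfin j, ← inner_conj_symm e (b j)]
      rw [← Complex.conj_mul']
      simp only [hsdef]
      push_cast
      simp
      ring
    rw [h4, inner_self_eq_norm_sq_to_K] at h3
    exact Complex.ofReal_injective ((Complex.ofReal_pow _ _).trans h3)
  have h5 : ‖T e‖ ^ 2 ≤ (∑ j, s j) ^ 2 := by
    rw [h2]
    calc ∑ j, s j ^ 2 * ‖inner ℂ (b j) e‖ ^ 2 ≤ ∑ j, s j ^ 2 := by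
          refine Finset.sum_le_sum fun j _ => mul_le_of_le_one_right (sq_nonneg _) ?_
          exact pow_le_one₀ (norm_nonneg _) (hb1 j)
      _ ≤ (∑ j, s j) ^ 2 := Finset.sum_sq_le_sq_sum_of_nonneg fun j _ => hs0 j
  rw [htn]
  exact h1.trans (le_of_sq_le_sq h5 (Finset.sum_nonneg fun j _ => hs0 j))

/-- Every unit vector is a column, at a prescribed place, of some unitary matrix. -/
theorem exists_unitary_column {ι : Type*} [Fintype ι] [DecidableEq ι] (v : ι → ℂ)
    (hv : ∑ i, ‖v i‖ ^ 2 = 1) (o : ι) :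
    ∃ F ∈ Matrix.unitaryGroup ι ℂ, ∀ y, F y o = v y := by
  set u : EuclideanSpace ℂ ι := WithLp.toLp 2 v with hu
  have hnorm : ‖u‖ = 1 := by
    rw [EuclideanSpace.norm_eq, hu]
    simp [hv]
  have horth : Orthonormal ℂ (({o} : Set ι).domRestrict fun _ => u) := by
    constructor
    · intro i
      simpa using hnorm
    · intro i j hij
      exact absurd (Subsingleton.elim i j) hij
  obtain ⟨b, hb⟩ := horth.exists_orthonormalBasis_extension_of_card_eq (by simp)
  refine ⟨(EuclideanSpace.basisFun ι ℂ).toBasis.toMatrix b,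
    OrthonormalBasis.toMatrix_orthonormalBasis_mem_unitary _ _, fun y => ?_⟩
  rw [Module.Basis.toMatrix_apply, hb o rfl]
  simp [hu]

/-! ### Parseval's identity for random phases -/

/-- The character `z ↦ ∏ᵢ ζ^(zᵢ cᵢ)` of `(ℤ/L)^ι`, where `ζ` is a primitive `L`-th root of unity. -/
noncomputable def phaseChar {ι : Type*} [Fintype ι] {L : ℕ} [NeZero L] (z c : ι → ZMod L) : ℂ :=
  ∏ y, ZMod.stdAddChar (z y * c y)

theorem sum_phaseChar_mul_conj {ι : Type*} [Fintype ι] [DecidableEq ι] {L : ℕ} [NeZero L]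
    (c c' : ι → ZMod L) :
    ∑ z : ι → ZMod L, phaseChar z c * starRingEnd ℂ (phaseChar z c') =
      if c = c' then (Fintype.card (ι → ZMod L) : ℂ) else 0 := by
  have h1 : ∀ z : ι → ZMod L, phaseChar z c * starRingEnd ℂ (phaseChar z c') =
      ∏ y, (ZMod.stdAddChar (z y * (c y - c' y)) : ℂ) := by
    intro z
    rw [phaseChar, phaseChar, map_prod, ← Finset.prod_mul_distrib]
    refine Finset.prod_congr rfl fun y _ => ?_
    rw [← AddChar.map_neg_eq_conj, ← AddChar.map_add_eq_mul]
    congr 1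
    ring
  simp_rw [h1]
  have h2 := Finset.prod_univ_sum (fun _ : ι => (Finset.univ : Finset (ZMod L)))
    (fun y t => (ZMod.stdAddChar (t * (c y - c' y)) : ℂ))
  rw [Fintype.piFinset_univ] at h2
  rw [← h2]
  simp_rw [AddChar.sum_mulShift _ (ZMod.isPrimitive_stdAddChar L)]
  split_ifs with h
  · subst h
    simp [ZMod.card]
  · obtain ⟨y, hy⟩ := Function.ne_iff.1 h
    refine Finset.prod_eq_zero (Finset.mem_univ y) ?_
    simp [sub_ne_zero.2 hy]

theorem sum_norm_sq_phaseChar {ι : Type*} [Fintype ι] [DecidableEq ι] {L : ℕ} [NeZero L]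
    (f : (ι → ZMod L) → ℂ) :
    ∑ z : ι → ZMod L, ‖∑ c, phaseChar z c * f c‖ ^ 2 =
      Fintype.card (ι → ZMod L) * ∑ c, ‖f c‖ ^ 2 := by
  have h : ((∑ z : ι → ZMod L, ‖∑ c, phaseChar z c * f c‖ ^ 2 : ℝ) : ℂ) =
      ((Fintype.card (ι → ZMod L) * ∑ c, ‖f c‖ ^ 2 : ℝ) : ℂ) := by
    push_cast
    simp_rw [← Complex.mul_conj', map_sum, map_mul, Finset.sum_mul_sum]
    rw [Finset.sum_comm, Finset.mul_sum]
    refine Finset.sum_congr rfl fun c _ => ?_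
    rw [Finset.sum_comm]
    have h1 : ∀ c', ∑ z : ι → ZMod L, phaseChar z c * f c *
        (starRingEnd ℂ (phaseChar z c') * starRingEnd ℂ (f c')) =
        f c * starRingEnd ℂ (f c') *
          if c = c' then (Fintype.card (ι → ZMod L) : ℂ) else 0 := by
      intro c'
      rw [← sum_phaseChar_mul_conj, Finset.mul_sum]
      exact Finset.sum_congr rfl fun z _ => by ring
    simp_rw [h1]
    simp
    ring
  exact_mod_cast h

theorem norm_stdAddChar {L : ℕ} [NeZero L] (t : ZMod L) : ‖(ZMod.stdAddChar t : ℂ)‖ = 1 :=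
  AddChar.norm_apply _ _

/-! ### Unravelling an algorithm into Kraus paths -/

/-- Apply the matrix `V` to the query register of a memory with workspace index set `κ`. -/
def queryVec {ι κ : Type*} [Fintype ι] (V : Matrix ι ι ℂ) (u : ι × κ → ℂ) : ι × κ → ℂ :=
  fun q => ∑ x, V q.1 x * u (x, q.2)

theorem kronecker_one_mulVec {ι κ : Type*} [Fintype ι] [Fintype κ] [DecidableEq κ]
    (V : Matrix ι ι ℂ) (u : ι × κ → ℂ) :
    (V ⊗ₖ (1 : Matrix κ κ ℂ)) *ᵥ u = queryVec V u := by
  ext ⟨y, w⟩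
  simp [Matrix.mulVec, dotProduct, Fintype.sum_prod_type, queryVec, Matrix.kroneckerMap_apply,
    Matrix.one_apply]

theorem queryVec_diagonal_mul {ι κ : Type*} [Fintype ι] [DecidableEq ι] (D : ι → ℂ)
    (V : Matrix ι ι ℂ) (u : ι × κ → ℂ) (q : ι × κ) :
    queryVec (Matrix.diagonal D * V) u q = D q.1 * queryVec V u q := by
  simp [queryVec, Matrix.diagonal_mul, Finset.mul_sum, mul_assoc]

theorem queryVec_sum_smul {ι κ τ : Type*} [Fintype ι] [Fintype τ]
    (V : Matrix ι ι ℂ) (a : τ → ℂ) (u : τ → ι × κ → ℂ) :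
    queryVec V (∑ c, a c • u c) = ∑ c, a c • queryVec V (u c) := by
  ext q
  simp only [queryVec, Finset.sum_apply, Pi.smul_apply, smul_eq_mul, Finset.mul_sum]
  rw [Finset.sum_comm]
  exact Finset.sum_congr rfl fun c _ => Finset.sum_congr rfl fun x _ => by ring

theorem sum_norm_sq_queryVec {ι κ : Type*} [Fintype ι] [DecidableEq ι] [Fintype κ]
    {V : Matrix ι ι ℂ} (hV : V ∈ Matrix.unitaryGroup ι ℂ) (u : ι × κ → ℂ) :
    ∑ y, ∑ w, ‖queryVec V u (y, w)‖ ^ 2 = ∑ q, ‖u q‖ ^ 2 := by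
  rw [Finset.sum_comm, Fintype.sum_prod_type_right]
  exact Finset.sum_congr rfl fun w _ => sum_norm_sq_unitary hV fun x => u (x, w)

namespace ForwardAlgorithm

variable {m : ℕ} (A : ForwardAlgorithm m)

/-- The choices that lead to stage `k`: a pure state in the initial mixture, indexed by `Fin r`, and
a Kraus operator of the outcome "continue" for each of the stages before. -/
def Path (r : ℕ) : ℕ → Type
  | 0 => Fin r
  | k + 1 => Path r k × Fin (A.contCount k)

instance Path.instFintype (r : ℕ) : (k : ℕ) → Fintype (A.Path r k)
  | 0 => inferInstanceAs (Fintype (Fin r))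
  | k + 1 =>
    haveI := Path.instFintype r k
    inferInstanceAs (Fintype (A.Path r k × Fin (A.contCount k)))

/-- The unnormalized pure state of the memory at stage `k` along a path. -/
def vec (X : Matrix (Reg m) (Reg m) ℂ) {r : ℕ} (u : Fin r → Reg m × Fin (A.work 0) → ℂ) :
    (k : ℕ) → A.Path r k → Reg m × Fin (A.work k) → ℂ
  | 0, l => u l
  | k + 1, p => queryVec X (A.cont k p.2 *ᵥ vec X u k p.1)

variable {A} {X : Matrix (Reg m) (Reg m) ℂ} {r : ℕ} {u : Fin r → Reg m × Fin (A.work 0) → ℂ}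

theorem sum_path_succ {R : Type*} [AddCommMonoid R] (k : ℕ) (f : A.Path r (k + 1) → R) :
    ∑ p, f p = ∑ p : A.Path r k, ∑ j : Fin (A.contCount k), f (p, j) :=
  Fintype.sum_prod_type (α₁ := A.Path r k) (α₂ := Fin (A.contCount k)) f

theorem stateAt_eq_sum (hu : A.init = ∑ l, Matrix.vecMulVec (u l) (star (u l))) (k : ℕ) :
    A.stateAt X k =
      ∑ p, Matrix.vecMulVec (A.vec X u k p) (star (A.vec X u k p)) := by
  induction k with
  | zero => exact hu
  | succ k ih =>
    rw [stateAt, ih, krausMap_sum_vecMulVec, Matrix.mul_sum, Matrix.sum_mul]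
    refine Fintype.sum_congr _ _ fun q => ?_
    rw [conj_vecMulVec_star_self, kronecker_one_mulVec]
    rfl

theorem trace_stateAt (hu : A.init = ∑ l, Matrix.vecMulVec (u l) (star (u l))) (k : ℕ) :
    (A.stateAt X k).trace.re = ∑ p, ∑ q, ‖A.vec X u k p q‖ ^ 2 := by
  rw [stateAt_eq_sum hu, Matrix.trace_sum]
  simp_rw [trace_vecMulVec_star_self]
  rw [← Complex.ofReal_sum, Complex.ofReal_re]

theorem outputAt_diag (hu : A.init = ∑ l, Matrix.vecMulVec (u l) (star (u l))) (k : ℕ)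
    (i : Fin m) :
    (A.outputAt X k i i).re = ∑ p, ∑ j, ‖(A.halt k j *ᵥ A.vec X u k p) i‖ ^ 2 := by
  rw [outputAt, stateAt_eq_sum hu, krausMap_sum_vecMulVec, Matrix.sum_apply]
  simp_rw [vecMulVec_star_self_diag]
  rw [← Complex.ofReal_sum, Complex.ofReal_re, Fintype.sum_prod_type]

/-- An instrument preserves the squared norm, summed over all its Kraus operators. -/
theorem sum_norm_sq_instrument (k : ℕ) (v : Reg m × Fin (A.work k) → ℂ) :
    ∑ j, ∑ i, ‖(A.halt k j *ᵥ v) i‖ ^ 2 + ∑ j, ∑ q, ‖(A.cont k j *ᵥ v) q‖ ^ 2 =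
      ∑ q, ‖v q‖ ^ 2 := by
  have h : ((∑ j, ∑ i, ‖(A.halt k j *ᵥ v) i‖ ^ 2 + ∑ j, ∑ q, ‖(A.cont k j *ᵥ v) q‖ ^ 2 : ℝ) : ℂ)
      = ((∑ q, ‖v q‖ ^ 2 : ℝ) : ℂ) := by
    rw [Complex.ofReal_add, Complex.ofReal_sum, Complex.ofReal_sum]
    simp_rw [sum_norm_sq_mulVec]
    rw [← dotProduct_sum, ← dotProduct_sum, ← Matrix.sum_mulVec, ← Matrix.sum_mulVec,
      ← dotProduct_add, ← Matrix.add_mulVec, A.complete k, Matrix.one_mulVec,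
      sum_norm_sq_eq_dotProduct]
  exact_mod_cast h

theorem trace_stateAt_succ (hu : A.init = ∑ l, Matrix.vecMulVec (u l) (star (u l)))
    (hX : X ∈ Matrix.unitaryGroup (Reg m) ℂ) (k : ℕ) :
    (A.stateAt X (k + 1)).trace.re =
      ∑ p, ∑ j, ∑ q, ‖(A.cont k j *ᵥ A.vec X u k p) q‖ ^ 2 := by
  rw [trace_stateAt hu, sum_path_succ]
  refine Fintype.sum_congr _ _ fun p => Fintype.sum_congr _ _ fun j => ?_
  rw [Fintype.sum_prod_type]
  exact sum_norm_sq_queryVec hX _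

variable (A)

theorem exists_init_eq_sum :
    ∃ (r : ℕ) (u : Fin r → Reg m × Fin (A.work 0) → ℂ),
      A.init = ∑ l, Matrix.vecMulVec (u l) (star (u l)) :=
  Matrix.posSemidef_iff_eq_sum_vecMulVec.1 A.init_posSemidef

variable {A}

theorem outputAt_diag_nonneg (k : ℕ) (i : Fin m) : 0 ≤ (A.outputAt X k i i).re := by
  obtain ⟨r, u, hu⟩ := A.exists_init_eq_sum
  rw [outputAt_diag hu]
  positivity

theorem trace_stateAt_nonneg (k : ℕ) : 0 ≤ (A.stateAt X k).trace.re := by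
  obtain ⟨r, u, hu⟩ := A.exists_init_eq_sum
  rw [trace_stateAt hu]
  positivity

/-- The probability of reaching a stage splits into those of halting there and of going on. -/
theorem trace_stateAt_eq (hX : X ∈ Matrix.unitaryGroup (Reg m) ℂ) (k : ℕ) :
    (A.stateAt X k).trace.re =
      ∑ i, (A.outputAt X k i i).re + (A.stateAt X (k + 1)).trace.re := by
  obtain ⟨r, u, hu⟩ := A.exists_init_eq_sum
  rw [trace_stateAt_succ hu hX, trace_stateAt hu]
  simp_rw [outputAt_diag hu]
  conv_rhs => arg 1; rw [Finset.sum_comm]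
  rw [← Finset.sum_add_distrib]
  refine Finset.sum_congr rfl fun p _ => ?_
  rw [← sum_norm_sq_instrument k, Finset.sum_comm]

theorem sum_outputAt_add_trace (hX : X ∈ Matrix.unitaryGroup (Reg m) ℂ) (n : ℕ) :
    ∑ k ∈ Finset.range n, ∑ i, (A.outputAt X k i i).re + (A.stateAt X n).trace.re = 1 := by
  induction n with
  | zero => simp [stateAt, A.init_trace]
  | succ n ih => rw [Finset.sum_range_succ, add_assoc, ← trace_stateAt_eq hX, ih]

theorem antitone_trace_stateAt (hX : X ∈ Matrix.unitaryGroup (Reg m) ℂ) :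
    Antitone fun k => (A.stateAt X k).trace.re := by
  refine antitone_nat_of_succ_le fun k => ?_
  rw [trace_stateAt_eq hX k]
  exact le_add_of_nonneg_left (Finset.sum_nonneg fun i _ => outputAt_diag_nonneg k i)

theorem trace_stateAt_le_one (hX : X ∈ Matrix.unitaryGroup (Reg m) ℂ) (k : ℕ) :
    (A.stateAt X k).trace.re ≤ 1 := by
  refine (antitone_trace_stateAt hX (Nat.zero_le k)).trans ?_
  simp [stateAt, A.init_trace]

/-- Markov's inequality for the number of queries. -/
theorem mul_trace_stateAt_le_of_expectedQueries_lt (hX : X ∈ Matrix.unitaryGroup (Reg m) ℂ) (n : ℕ)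
    {B : ℝ} (hB : A.expectedQueries X < ENNReal.ofReal B) :
    (n + 1) * (A.stateAt X (n + 1)).trace.re ≤ B := by
  have h1 : ENNReal.ofReal ((n + 1) * (A.stateAt X (n + 1)).trace.re) ≤ A.expectedQueries X := by
    calc ENNReal.ofReal ((n + 1) * (A.stateAt X (n + 1)).trace.re)
        ≤ ENNReal.ofReal (∑ k ∈ Finset.range (n + 1), (A.stateAt X (k + 1)).trace.re) := by
          refine ENNReal.ofReal_le_ofReal ?_
          have := Finset.card_nsmul_le_sum (Finset.range (n + 1))
            (fun k => (A.stateAt X (k + 1)).trace.re) (A.stateAt X (n + 1)).trace.re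
            fun k hk => antitone_trace_stateAt hX (by grind)
          simpa using this
      _ = ∑ k ∈ Finset.range (n + 1), ENNReal.ofReal (A.stateAt X (k + 1)).trace.re :=
          ENNReal.ofReal_sum_of_nonneg fun k _ => trace_stateAt_nonneg _
      _ ≤ A.expectedQueries X := ENNReal.sum_le_tsum _
  have h2 := h1.trans_lt hB
  exact (ENNReal.ofReal_lt_ofReal_iff'.1 h2).1.le

/-- If the output is close to the basis state `|i₀⟩`, then the outputs of the first `n` stages put
little weight on the other basis states. -/
theorem sum_outputAt_off_le (hX : X ∈ Matrix.unitaryGroup (Reg m) ℂ) {ρ : Matrix (Fin m) (Fin m) ℂ}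
    (hρ : A.Outputs X ρ) {φ : Fin m → ℂ} {i₀ : Fin m} (hφ : ‖φ i₀‖ = 1)
    (hd : traceDist ρ (proj φ) ≤ 0.01) (n : ℕ) :
    ∑ k ∈ Finset.range n, ∑ i ∈ Finset.univ.erase i₀, (A.outputAt X k i i).re ≤ 0.02 := by
  have hsum : ∀ i, HasSum (fun k => (A.outputAt X k i i).re) (ρ i i).re := fun i =>
    Complex.hasSum_re (Pi.hasSum.1 (Pi.hasSum.1 hρ i) i)
  have htr : ∑ i, (ρ i i).re ≤ 1 := by
    refine le_of_tendsto' (hasSum_sum fun i _ => hsum i).tendsto_sum_nat fun N => ?_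
    have := sum_outputAt_add_trace (A := A) hX N
    linarith [trace_stateAt_nonneg (A := A) (X := X) N]
  have h1 : 0.98 ≤ (ρ i₀ i₀).re := by
    have h2 := norm_diag_le_traceNorm (ρ - proj φ) i₀
    rw [traceDist] at hd
    have h3 : (ρ - proj φ) i₀ i₀ = ρ i₀ i₀ - 1 := by
      rw [Matrix.sub_apply, proj, vecMulVec_star_self_diag, hφ]
      simp
    rw [h3] at h2
    have h4 := Complex.abs_re_le_norm (ρ i₀ i₀ - 1)
    rw [Complex.sub_re, Complex.one_re] at h4
    have := (abs_le.1 (h4.trans h2)).1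
    linarith
  rw [← Finset.add_sum_erase _ _ (Finset.mem_univ i₀)] at htr
  have h5 : ∑ k ∈ Finset.range n, ∑ i ∈ Finset.univ.erase i₀, (A.outputAt X k i i).re ≤
      ∑ i ∈ Finset.univ.erase i₀, (ρ i i).re :=
    sum_le_hasSum _ (fun k _ => Finset.sum_nonneg fun i _ => outputAt_diag_nonneg k i)
      (hasSum_sum fun i _ => hsum i)
  linarith

end ForwardAlgorithm

namespace ForwardAlgorithm

/-! ### Recording the query outputs by random phases -/

variable {m : ℕ} (A : ForwardAlgorithm m)

/-- The Fourier coefficient at `c` of the state along a path, as a function of random phases `z` by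
which the outputs of the queries to `V` are multiplied. The number `c y` counts, modulo `L`, how
often the query output was `y`. -/
def cvec {L : ℕ} [NeZero L] (V : Matrix (Reg m) (Reg m) ℂ) {r : ℕ}
    (u : Fin r → Reg m × Fin (A.work 0) → ℂ) :
    (k : ℕ) → A.Path r k → (Reg m → ZMod L) → Reg m × Fin (A.work k) → ℂ
  | 0, l, c => if c = 0 then u l else 0
  | k + 1, p, c => fun q =>
    queryVec V (A.cont k p.2 *ᵥ cvec V u k p.1 (c - Pi.single q.1 1)) q

variable {A} {L : ℕ} [NeZero L] {V : Matrix (Reg m) (Reg m) ℂ} {r : ℕ}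
  {u : Fin r → Reg m × Fin (A.work 0) → ℂ}

theorem stdAddChar_mul_phaseChar {ι : Type*} [Fintype ι] [DecidableEq ι] (z c : ι → ZMod L)
    (y : ι) :
    ZMod.stdAddChar (z y) * phaseChar z c = phaseChar z (c + Pi.single y 1) := by
  simp only [phaseChar, Pi.add_apply, mul_add, AddChar.map_add_eq_mul, Finset.prod_mul_distrib]
  rw [mul_comm]
  congr 1
  rw [Finset.prod_eq_single y]
  · simp
  · intro b _ hb
    simp [Pi.single_eq_of_ne hb]
  · simp

theorem vec_eq_sum_cvec (z : Reg m → ZMod L) (k : ℕ) (p : A.Path r k) :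
    A.vec (Matrix.diagonal (fun y => ZMod.stdAddChar (z y)) * V) u k p =
      ∑ c, phaseChar z c • A.cvec V u k p c := by
  induction k with
  | zero =>
    rw [Finset.sum_eq_single 0]
    · simp [vec, cvec, phaseChar]
    · intro c _ hc
      simp [cvec, hc]
    · simp
  | succ k ih =>
    ext q
    rw [vec, queryVec_diagonal_mul, ih, Matrix.mulVec_sum]
    simp_rw [Matrix.mulVec_smul]
    rw [queryVec_sum_smul, Finset.sum_apply, Finset.sum_apply, Finset.mul_sum]
    refine Fintype.sum_equiv (Equiv.addRight (Pi.single q.1 1)) _ _ fun c => ?_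
    simp only [Pi.smul_apply, smul_eq_mul, Equiv.coe_addRight, cvec, add_sub_cancel_right]
    rw [← mul_assoc, stdAddChar_mul_phaseChar]

/-- No count exceeds the number of queries. -/
theorem cvec_eq_zero_of_lt_val {k : ℕ} {p : A.Path r k} {c : Reg m → ZMod L} {y : Reg m}
    (h : k < (c y).val) : A.cvec V u k p c = 0 := by
  induction k generalizing c with
  | zero =>
    have : c ≠ 0 := by
      rintro rfl
      simp at h
    simp [cvec, this]
  | succ k ih =>
    ext q
    have h1 : k < ((c - Pi.single q.1 1 : Reg m → ZMod L) y).val := by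
      rcases eq_or_ne y q.1 with rfl | hy
      · rw [Pi.sub_apply, Pi.single_eq_same]
        have hL : 1 < L := by
          have := (c q.1).val_lt
          omega
        have : Fact (1 < L) := ⟨hL⟩
        rw [ZMod.val_sub (by rw [ZMod.val_one]; omega), ZMod.val_one]
        omega
      · rw [Pi.sub_apply, Pi.single_eq_of_ne hy, sub_zero]
        omega
    simp [cvec, ih h1, queryVec]

/-- At most `k` rows are used by `k` queries. -/
theorem cvec_eq_zero_of_lt_card {k : ℕ} {p : A.Path r k} {c : Reg m → ZMod L}
    (h : k < (Finset.univ.filter fun y => c y ≠ 0).card) : A.cvec V u k p c = 0 := by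
  induction k generalizing c with
  | zero =>
    have : c ≠ 0 := by
      rintro rfl
      simp at h
    simp [cvec, this]
  | succ k ih =>
    ext q
    have h1 : k < (Finset.univ.filter fun y => (c - Pi.single q.1 1 : Reg m → ZMod L) y ≠ 0).card := by
      have h2 : (Finset.univ.filter fun y => c y ≠ 0) ⊆
          insert q.1 (Finset.univ.filter fun y => (c - Pi.single q.1 1 : Reg m → ZMod L) y ≠ 0) := by
        intro y hy
        rcases eq_or_ne y q.1 with rfl | hne
        · exact Finset.mem_insert_self _ _
        · simpa [hne] using hy
      have := (Finset.card_le_card h2).trans (Finset.card_insert_le _ _)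
      omega
    simp [cvec, ih h1, queryVec]

/-- The coefficient at `c` depends only on the rows of `V` that are recorded in `c`. -/
theorem cvec_congr {V' : Matrix (Reg m) (Reg m) ℂ} {k : ℕ} (hk : k < L) {p : A.Path r k}
    {c : Reg m → ZMod L} (h : ∀ y, c y ≠ 0 → V y = V' y) :
    A.cvec V u k p c = A.cvec V' u k p c := by
  induction k generalizing c with
  | zero => rfl
  | succ k ih =>
    ext q
    by_cases hq : c q.1 = 0
    · -- A count of `0` after an output `q.1` needs at least `L` queries with this output.
      have h1 : k < ((c - Pi.single q.1 1 : Reg m → ZMod L) q.1).val := by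
        rw [Pi.sub_apply, Pi.single_eq_same, hq, zero_sub]
        obtain ⟨n, rfl⟩ : ∃ n, L = n + 1 := ⟨L - 1, by omega⟩
        rw [ZMod.val_neg_one]
        omega
      simp [cvec, cvec_eq_zero_of_lt_val h1, queryVec]
    · have h1 : ∀ y, (c - Pi.single q.1 1 : Reg m → ZMod L) y ≠ 0 → V y = V' y := by
        intro y hy
        rcases eq_or_ne y q.1 with rfl | hne
        · exact h _ hq
        · exact h y (by simpa [hne] using hy)
      simp only [cvec, ih (by omega) h1, queryVec, h q.1 hq]

theorem sum_norm_sq_mulVec_vec {κ : Type*} (k : ℕ) (p : A.Path r k)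
    (H : Matrix κ (Reg m × Fin (A.work k)) ℂ) (i : κ) :
    ∑ z : Reg m → ZMod L,
        ‖(H *ᵥ A.vec (Matrix.diagonal (fun y => ZMod.stdAddChar (z y)) * V) u k p) i‖ ^ 2 =
      Fintype.card (Reg m → ZMod L) *
        ∑ c : Reg m → ZMod L, ‖(H *ᵥ A.cvec V u k p c) i‖ ^ 2 := by
  rw [← sum_norm_sq_phaseChar]
  refine Finset.sum_congr rfl fun z _ => ?_
  rw [vec_eq_sum_cvec, Matrix.mulVec_sum, Finset.sum_apply]
  simp_rw [Matrix.mulVec_smul, Pi.smul_apply, smul_eq_mul]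

/-! ### The sector in which two distinguished rows are never used -/

/-- The count vectors in which neither of the rows `o` and `o'` is recorded. -/
def avoiding (L : ℕ) [NeZero L] (o o' : Reg m) : Finset (Reg m → ZMod L) :=
  Finset.univ.filter fun c => c o = 0 ∧ c o' = 0

variable (A L V u)

/-- The weight of the memory at stage `k` in the sector that avoids the rows `o` and `o'`. -/
noncomputable def stateWeight (o o' : Reg m) (k : ℕ) : ℝ :=
  ∑ p, ∑ c ∈ avoiding L o o', ∑ q, ‖A.cvec V u k p c q‖ ^ 2

/-- The weight of the output `i` at stage `k` in the sector that avoids the rows `o` and `o'`. -/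
noncomputable def haltWeight (o o' : Reg m) (k : ℕ) (i : Fin m) : ℝ :=
  ∑ p, ∑ c ∈ avoiding L o o', ∑ j, ‖(A.halt k j *ᵥ A.cvec V u k p c) i‖ ^ 2

/-- The weight of the outcome "continue" of the instrument at stage `k` in the sector that avoids
the rows `o` and `o'`. -/
noncomputable def contWeight (o o' : Reg m) (k : ℕ) : ℝ :=
  ∑ p, ∑ j, ∑ c ∈ avoiding L o o', ∑ q, ‖(A.cont k j *ᵥ A.cvec V u k p c) q‖ ^ 2

/-- The weight with which the query at the end of stage `k` leaves the sector that avoids the rows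
`o` and `o'` by producing the output `y`. -/
noncomputable def hitWeight (o o' : Reg m) (k : ℕ) (y : Reg m) : ℝ :=
  ∑ p, ∑ j, ∑ c ∈ avoiding L o o',
    ∑ w, ‖queryVec V (A.cont k j *ᵥ A.cvec V u k p c) (y, w)‖ ^ 2

variable {A L V u}

theorem stateWeight_eq (o o' : Reg m) (k : ℕ) :
    A.stateWeight L V u o o' k =
      ∑ i, A.haltWeight L V u o o' k i + A.contWeight L V u o o' k := by
  simp only [stateWeight, haltWeight, contWeight]
  rw [Finset.sum_comm (s := (Finset.univ : Finset (Fin m))), ← Finset.sum_add_distrib]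
  refine Finset.sum_congr rfl fun p _ => ?_
  rw [Finset.sum_comm (s := (Finset.univ : Finset (Fin m))),
    Finset.sum_comm (s := (Finset.univ : Finset (Fin _))), ← Finset.sum_add_distrib]
  refine Finset.sum_congr rfl fun c _ => ?_
  rw [← sum_norm_sq_instrument k, Finset.sum_comm (s := (Finset.univ : Finset (Fin m)))]

/-- A query that does not output `o` or `o'` stays in the sector. -/
theorem contWeight_le (hV : V ∈ Matrix.unitaryGroup (Reg m) ℂ) (o o' : Reg m) (k : ℕ) :
    A.contWeight L V u o o' k ≤ A.stateWeight L V u o o' (k + 1) +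
      (A.hitWeight L V u o o' k o + A.hitWeight L V u o o' k o') := by
  simp only [stateWeight, hitWeight, contWeight]
  rw [sum_path_succ]
  simp only [← Finset.sum_add_distrib]
  refine Finset.sum_le_sum fun p _ => Finset.sum_le_sum fun j _ => ?_
  set g : (Reg m → ZMod L) → Reg m → ℝ := fun c y =>
    ∑ w, ‖queryVec V (A.cont k j *ᵥ A.cvec V u k p c) (y, w)‖ ^ 2 with hg
  have hg0 : ∀ c y, 0 ≤ g c y := fun c y => by positivity
  have h1 : ∀ c, ∑ q, ‖(A.cont k j *ᵥ A.cvec V u k p c) q‖ ^ 2 = ∑ y, g c y := fun c =>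
    (sum_norm_sq_queryVec hV _).symm
  have h2 : ∀ c, ∑ q, ‖A.cvec V u (k + 1) (p, j) c q‖ ^ 2 =
      ∑ y, g (c - Pi.single y 1) y := fun c => by
    rw [Fintype.sum_prod_type]
    rfl
  set R : Finset (Reg m) := (Finset.univ.erase o).erase o' with hR
  have h3 : ∀ c, ∑ y, g c y ≤ (g c o + g c o') + ∑ y ∈ R, g c y := by
    intro c
    rw [← Finset.add_sum_erase _ _ (Finset.mem_univ o)]
    by_cases ho : o' = o
    · have : R = Finset.univ.erase o := by simp [hR, ho]
      rw [this]
      linarith [hg0 c o']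
    · rw [← Finset.add_sum_erase _ _ (Finset.mem_erase.2 ⟨ho, Finset.mem_univ o'⟩), add_assoc]
  have h4 : ∑ c ∈ avoiding L o o', ∑ y ∈ R, g c y ≤
      ∑ c ∈ avoiding L o o', ∑ y, g (c - Pi.single y 1) y := by
    calc ∑ c ∈ avoiding L o o', ∑ y ∈ R, g c y
        = ∑ c ∈ avoiding L o o', ∑ y ∈ R, g (c - Pi.single y 1) y := by
          rw [Finset.sum_comm]
          conv_rhs => rw [Finset.sum_comm]
          refine Finset.sum_congr rfl fun y hy => ?_
          have hyo : o ≠ y := by grind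
          have hyo' : o' ≠ y := by grind
          refine Finset.sum_equiv (Equiv.addRight (Pi.single y 1)) (fun c => ?_) fun c _ => ?_
          · simp [avoiding, Pi.single_eq_of_ne hyo, Pi.single_eq_of_ne hyo']
          · simp
      _ ≤ _ := Finset.sum_le_sum fun c _ =>
          Finset.sum_le_univ_sum_of_nonneg fun y => hg0 _ _
  have h5 : ∑ c ∈ avoiding L o o', ∑ y, g c y ≤
      ∑ c ∈ avoiding L o o', (g c o + g c o') + ∑ c ∈ avoiding L o o', ∑ y ∈ R, g c y := by
    rw [← Finset.sum_add_distrib]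
    exact Finset.sum_le_sum fun c _ => h3 c
  simp only [h1, h2, Finset.sum_add_distrib] at h5 ⊢
  linarith

theorem stateWeight_zero (hu : A.init = ∑ l, Matrix.vecMulVec (u l) (star (u l))) (o o' : Reg m) :
    A.stateWeight L V u o o' 0 = 1 := by
  have h := trace_stateAt (X := 1) hu 0
  rw [stateAt, A.init_trace, Complex.one_re] at h
  rw [h, stateWeight]
  refine Finset.sum_congr rfl fun p _ => ?_
  rw [Finset.sum_eq_single 0]
  · simp [cvec, vec]
  · intro c _ hc
    simp [cvec, hc]
  · simp [avoiding]

/-- The weights in the sector are lower bounds for the averages over the random phases. -/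
theorem card_mul_contWeight_le (hu : A.init = ∑ l, Matrix.vecMulVec (u l) (star (u l)))
    (hX : ∀ z : Reg m → ZMod L, Matrix.diagonal (fun y => ZMod.stdAddChar (z y)) * V ∈
      Matrix.unitaryGroup (Reg m) ℂ) (o o' : Reg m) (k : ℕ) :
    Fintype.card (Reg m → ZMod L) * A.contWeight L V u o o' k ≤
      ∑ z : Reg m → ZMod L,
        (A.stateAt (Matrix.diagonal (fun y => ZMod.stdAddChar (z y)) * V) (k + 1)).trace.re := by
  simp_rw [trace_stateAt_succ hu (hX _), contWeight]
  rw [Finset.sum_comm (s := (Finset.univ : Finset (Reg m → ZMod L))), Finset.mul_sum]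
  refine Finset.sum_le_sum fun p _ => ?_
  rw [Finset.sum_comm (s := (Finset.univ : Finset (Reg m → ZMod L))), Finset.mul_sum]
  refine Finset.sum_le_sum fun j _ => ?_
  rw [Finset.sum_comm (s := (Finset.univ : Finset (Reg m → ZMod L))),
    Finset.sum_comm (s := avoiding L o o'), Finset.mul_sum]
  refine Finset.sum_le_sum fun q _ => ?_
  rw [sum_norm_sq_mulVec_vec]
  refine mul_le_mul_of_nonneg_left ?_ (Nat.cast_nonneg _)
  exact Finset.sum_le_sum_of_subset_of_nonneg (Finset.subset_univ _) fun c _ _ => sq_nonneg _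

/-- A bound for the probability of a further query on all instances bounds the weight of "continue"
in the sector. -/
theorem contWeight_le_of_forall {V : Matrix (Reg m) (Reg m) ℂ}
    (hu : A.init = ∑ l, Matrix.vecMulVec (u l) (star (u l)))
    (hX : ∀ z : Reg m → ZMod L, Matrix.diagonal (fun y => ZMod.stdAddChar (z y)) * V ∈
      Matrix.unitaryGroup (Reg m) ℂ) (o o' : Reg m) (k : ℕ) {ε : ℝ}
    (hε : ∀ z : Reg m → ZMod L,
      (A.stateAt (Matrix.diagonal (fun y => ZMod.stdAddChar (z y)) * V) (k + 1)).trace.re ≤ ε) :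
    A.contWeight L V u o o' k ≤ ε := by
  have hZ : (0 : ℝ) < Fintype.card (Reg m → ZMod L) := by exact_mod_cast Fintype.card_pos
  refine le_of_mul_le_mul_left ((card_mul_contWeight_le hu hX o o' k).trans ?_) hZ
  refine (Finset.sum_le_sum fun z _ => hε z).trans_eq ?_
  rw [Finset.sum_const, Finset.card_univ, nsmul_eq_mul]

theorem card_mul_haltWeight_le (hu : A.init = ∑ l, Matrix.vecMulVec (u l) (star (u l)))
    (o o' : Reg m) (k : ℕ) (i : Fin m) :
    Fintype.card (Reg m → ZMod L) * A.haltWeight L V u o o' k i ≤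
      ∑ z : Reg m → ZMod L,
        (A.outputAt (Matrix.diagonal (fun y => ZMod.stdAddChar (z y)) * V) k i i).re := by
  simp_rw [outputAt_diag hu, haltWeight]
  rw [Finset.sum_comm (s := (Finset.univ : Finset (Reg m → ZMod L))), Finset.mul_sum]
  refine Finset.sum_le_sum fun p _ => ?_
  rw [Finset.sum_comm (s := (Finset.univ : Finset (Reg m → ZMod L))),
    Finset.sum_comm (s := avoiding L o o'), Finset.mul_sum]
  refine Finset.sum_le_sum fun q _ => ?_
  rw [sum_norm_sq_mulVec_vec]
  refine mul_le_mul_of_nonneg_left ?_ (Nat.cast_nonneg _)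
  exact Finset.sum_le_sum_of_subset_of_nonneg (Finset.subset_univ _) fun c _ _ => sq_nonneg _

theorem haltWeight_congr {V' : Matrix (Reg m) (Reg m) ℂ} {o o' : Reg m} {k : ℕ} (hk : k < L)
    (h : ∀ y, y ≠ o → y ≠ o' → V y = V' y) (i : Fin m) :
    A.haltWeight L V u o o' k i = A.haltWeight L V' u o o' k i := by
  simp only [haltWeight]
  refine Finset.sum_congr rfl fun p _ => Finset.sum_congr rfl fun c hc => ?_
  rw [cvec_congr hk (V' := V')]
  intro y hy
  simp only [avoiding, Finset.mem_filter, Finset.mem_univ, true_and] at hc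
  refine h y ?_ ?_
  · rintro rfl
    exact hy hc.1
  · rintro rfl
    exact hy hc.2

end ForwardAlgorithm

/-! ### Hiding a row by permuting the rows of a unitary -/

/-- The permutations of the rows that leave the column `v` unchanged. -/
abbrev ColumnPerm {ι : Type*} (v : ι → ℝ) : Type _ :=
  {π : Equiv.Perm ι // ∀ y, v (π y) = v y}

/-- Transposing two rows with equal entries in the column `v` acts on `ColumnPerm v`. -/
def ColumnPerm.mulSwap {ι : Type*} [DecidableEq ι] {v : ι → ℝ} {y y' : ι} (h : v y = v y') :
    Equiv.Perm (ColumnPerm v) where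
  toFun π := ⟨π.1 * Equiv.swap y y', fun x => by
    rw [Equiv.Perm.mul_apply, π.2, Equiv.swap_apply_def]
    split_ifs <;> simp_all⟩
  invFun π := ⟨π.1 * Equiv.swap y y', fun x => by
    rw [Equiv.Perm.mul_apply, π.2, Equiv.swap_apply_def]
    split_ifs <;> simp_all⟩
  left_inv π := by
    ext
    simp
  right_inv π := by
    ext
    simp

theorem submatrix_perm_mem_unitaryGroup {ι : Type*} [Fintype ι] [DecidableEq ι]
    {F : Matrix ι ι ℂ} (hF : F ∈ Matrix.unitaryGroup ι ℂ) (π : Equiv.Perm ι) :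
    F.submatrix π id ∈ Matrix.unitaryGroup ι ℂ := by
  rw [Matrix.mem_unitaryGroup_iff, Matrix.star_eq_conjTranspose] at hF ⊢
  rw [Matrix.conjTranspose_submatrix]
  have h := Matrix.submatrix_mul_equiv F Fᴴ π (Equiv.refl ι) π
  rw [Equiv.coe_refl] at h
  rw [h, hF, Matrix.submatrix_one_equiv]

theorem diagonal_mem_unitaryGroup {ι : Type*} [Fintype ι] [DecidableEq ι] {D : ι → ℂ}
    (hD : ∀ i, ‖D i‖ = 1) : Matrix.diagonal D ∈ Matrix.unitaryGroup ι ℂ := by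
  rw [Matrix.mem_unitaryGroup_iff, Matrix.star_eq_conjTranspose, Matrix.diagonal_conjTranspose,
    Matrix.diagonal_mul_diagonal, ← Matrix.diagonal_one]
  congr 1
  ext i
  simp [Complex.mul_conj', hD]

namespace ForwardAlgorithm

variable {m : ℕ} {A : ForwardAlgorithm m} {L : ℕ} [NeZero L] {r : ℕ}
  {u : Fin r → Reg m × Fin (A.work 0) → ℂ}

/-- As long as the row `y₀` is not recorded in `c`, the state cannot tell it from the other rows that
are not recorded in `c` and have the same entry in the column `v`. There are at least `N - k` of
these, where `N` is the number of rows with this entry, and so a query outputs `y₀` with probability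
at most `1 / (N - k)`. -/
theorem mul_sum_norm_sq_row_le {F : Matrix (Reg m) (Reg m) ℂ} {v : Reg m → ℝ}
    {k : ℕ} (hk : k < L) (p : A.Path r k) (j : Fin (A.contCount k)) {c : Reg m → ZMod L}
    {y₀ : Reg m} (hc : c y₀ = 0) {N : ℕ} (hN : N ≤ (Finset.univ.filter fun y => v y = v y₀).card) :
    ((N : ℝ) - k) * ∑ π : ColumnPerm v, ∑ w, ‖queryVec (F.submatrix π.1 id)
        (A.cont k j *ᵥ A.cvec (F.submatrix π.1 id) u k p c) (y₀, w)‖ ^ 2 ≤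
      ∑ π : ColumnPerm v, ∑ y, ∑ w, ‖queryVec (F.submatrix π.1 id)
        (A.cont k j *ᵥ A.cvec (F.submatrix π.1 id) u k p c) (y, w)‖ ^ 2 := by
  set G : ColumnPerm v → Reg m → ℝ := fun π y => ∑ w, ‖queryVec (F.submatrix π.1 id)
        (A.cont k j *ᵥ A.cvec (F.submatrix π.1 id) u k p c) (y, w)‖ ^ 2 with hG
  have hG0 : ∀ π y, 0 ≤ G π y := fun π y => by positivity
  change ((N : ℝ) - k) * ∑ π, G π y₀ ≤ ∑ π, ∑ y, G π y
  rcases lt_or_ge k (Finset.univ.filter fun y => c y ≠ 0).card with hlt | hge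
  · have h0 : ∀ π y, G π y = 0 := fun π y => by
      simp [hG, cvec_eq_zero_of_lt_card hlt, queryVec]
    simp [h0]
  set U : Finset (Reg m) := Finset.univ.filter fun y => v y = v y₀ ∧ c y = 0 with hU
  have hcard : (N : ℝ) - k ≤ U.card := by
    have h1 : (Finset.univ.filter fun y => v y = v y₀) ⊆
        U ∪ Finset.univ.filter fun y => c y ≠ 0 := by
      intro y hy
      by_cases hy' : c y = 0 <;> simp_all
    have h2 := (Finset.card_le_card h1).trans (Finset.card_union_le _ _)
    have h3 : N ≤ U.card + k := by omega
    rw [sub_le_iff_le_add]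
    exact_mod_cast h3
  have hswap : ∀ y ∈ U, ∑ π, G π y₀ = ∑ π, G π y := by
    intro y hy
    simp only [hU, Finset.mem_filter, Finset.mem_univ, true_and] at hy
    refine (Fintype.sum_equiv (ColumnPerm.mulSwap hy.1.symm) _ _ fun π => ?_).symm
    have hcv : A.cvec (F.submatrix (π.1 * Equiv.swap y₀ y : Equiv.Perm (Reg m)) id) u k p c =
        A.cvec (F.submatrix π.1 id) u k p c := by
      refine cvec_congr hk fun x hx => ?_
      have hx0 : x ≠ y₀ := by
        rintro rfl
        exact hx hc
      have hxy : x ≠ y := by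
        rintro rfl
        exact hx hy.2
      ext x'
      simp [Equiv.swap_apply_of_ne_of_ne hx0 hxy]
    simp only [hG, ColumnPerm.mulSwap, Equiv.coe_fn_mk]
    rw [hcv]
    simp [queryVec]
  calc ((N : ℝ) - k) * ∑ π, G π y₀ ≤ U.card * ∑ π, G π y₀ :=
        mul_le_mul_of_nonneg_right hcard
          (Finset.sum_nonneg fun π _ => hG0 π y₀)
    _ = ∑ y ∈ U, ∑ π, G π y := by
        rw [← nsmul_eq_mul, ← Finset.sum_const]
        exact Finset.sum_congr rfl hswap
    _ = ∑ π, ∑ y ∈ U, G π y := Finset.sum_comm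
    _ ≤ ∑ π, ∑ y, G π y := Finset.sum_le_sum fun π _ =>
        Finset.sum_le_univ_sum_of_nonneg fun y => hG0 π y

theorem mul_sum_hitWeight_le {F : Matrix (Reg m) (Reg m) ℂ}
    (hF : F ∈ Matrix.unitaryGroup (Reg m) ℂ) {v : Reg m → ℝ}
    {k : ℕ} (hk : k < L) {o o' y₀ : Reg m} (hy₀ : y₀ = o ∨ y₀ = o') {N : ℕ}
    (hN : N ≤ (Finset.univ.filter fun y => v y = v y₀).card) :
    ((N : ℝ) - k) * ∑ π : ColumnPerm v, A.hitWeight L (F.submatrix π.1 id) u o o' k y₀ ≤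
      ∑ π : ColumnPerm v, A.contWeight L (F.submatrix π.1 id) u o o' k := by
  simp only [hitWeight, contWeight]
  rw [Finset.sum_comm, Finset.sum_comm (s := (Finset.univ : Finset (ColumnPerm v))),
    Finset.mul_sum]
  refine Finset.sum_le_sum fun p _ => ?_
  rw [Finset.sum_comm, Finset.sum_comm (s := (Finset.univ : Finset (ColumnPerm v))),
    Finset.mul_sum]
  refine Finset.sum_le_sum fun j _ => ?_
  rw [Finset.sum_comm, Finset.sum_comm (s := (Finset.univ : Finset (ColumnPerm v))),
    Finset.mul_sum]
  refine Finset.sum_le_sum fun c hc => ?_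
  have hc' : c y₀ = 0 := by
    simp only [avoiding, Finset.mem_filter, Finset.mem_univ, true_and] at hc
    rcases hy₀ with rfl | rfl
    exacts [hc.1, hc.2]
  refine (mul_sum_norm_sq_row_le hk p j hc' hN).trans_eq ?_
  exact Finset.sum_congr rfl fun π _ =>
    sum_norm_sq_queryVec (submatrix_perm_mem_unitaryGroup hF π.1) _

theorem one_le_sum_haltWeight_add {V : Matrix (Reg m) (Reg m) ℂ}
    (hV : V ∈ Matrix.unitaryGroup (Reg m) ℂ)
    (hu : A.init = ∑ l, Matrix.vecMulVec (u l) (star (u l))) (o o' : Reg m) (n : ℕ) :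
    1 ≤ ∑ k ∈ Finset.range (n + 1), ∑ i, A.haltWeight L V u o o' k i +
      ∑ k ∈ Finset.range n, (A.hitWeight L V u o o' k o + A.hitWeight L V u o o' k o') +
      A.contWeight L V u o o' n := by
  induction n with
  | zero =>
    have h := stateWeight_eq (A := A) (L := L) (V := V) (u := u) o o' 0
    rw [stateWeight_zero hu] at h
    simp [h]
  | succ n ih =>
    rw [Finset.sum_range_succ _ (n + 1), Finset.sum_range_succ
      (fun k => A.hitWeight L V u o o' k o + A.hitWeight L V u o o' k o') n]
    have h1 := contWeight_le (A := A) (L := L) (u := u) hV o o' n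
    rw [stateWeight_eq] at h1
    linarith

end ForwardAlgorithm

/-! ### The hard instances -/

theorem isInstance_of_column {m : ℕ} [NeZero m] {X : Matrix (Reg m) (Reg m) ℂ} {a : ℝ}
    {φ : Fin m → ℂ} (hX : X ∈ Matrix.unitaryGroup (Reg m) ℂ) (ha0 : 0 ≤ a) (ha1 : a ≤ 1)
    (hφ : IsPureState φ) (hcol : ∀ i, X (i, 0) (0, 0) = a * φ i) : IsInstance X a φ := by
  have hnorm : ∑ i, ‖X (i, 0) (0, 0)‖ ^ 2 + ∑ i, ‖X (i, 1) (0, 0)‖ ^ 2 = 1 := by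
    have h := sum_norm_sq_unitary hX (Pi.single (0, 0) 1)
    rw [Fintype.sum_prod_type_right, Fin.sum_univ_two] at h
    simpa [Pi.single_apply, apply_ite] using h
  have h0 : ∑ i, ‖X (i, 0) (0, 0)‖ ^ 2 = a ^ 2 := by
    simp_rw [hcol, norm_mul, mul_pow, ← Finset.mul_sum]
    rw [hφ]
    simp
  have hs : Real.sqrt (1 - a ^ 2) ^ 2 = 1 - a ^ 2 := Real.sq_sqrt (by nlinarith)
  refine ⟨hX, ha0, ha1, hφ, ?_⟩
  by_cases hz : Real.sqrt (1 - a ^ 2) = 0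
  · have h1 : ∑ i, ‖X (i, 1) (0, 0)‖ ^ 2 = 0 := by
      rw [hz] at hs
      linarith
    refine ⟨φ, hφ, fun i => ⟨hcol i, ?_⟩⟩
    have := (Finset.sum_eq_zero_iff_of_nonneg (fun i _ => by positivity)).1 h1 i
      (Finset.mem_univ i)
    rw [hz]
    simpa using this
  · refine ⟨fun i => X (i, 1) (0, 0) / Real.sqrt (1 - a ^ 2), ?_, fun i => ⟨hcol i, ?_⟩⟩
    · simp only [IsPureState, norm_div, div_pow, ← Finset.sum_div]
      rw [Complex.norm_real, Real.norm_eq_abs, sq_abs, hs, div_eq_one_iff_eq]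
      · linarith
      · rw [← hs]
        positivity
    · rw [mul_div_cancel₀]
      exact_mod_cast hz

/-- A unit vector in `ℂ^m ⊗ ℂ^2` with at least `M` entries `a`; its only nonzero entry with the flag
`0` is `a` at `(0, 0)`. -/
theorem exists_column {m : ℕ} [NeZero m] {M : ℕ} {a : ℝ} (hM1 : 1 ≤ M) (hMm : M ≤ m)
    (hMa : M * a ^ 2 ≤ 1) :
    ∃ v : Reg m → ℝ, ∑ y, v y ^ 2 = 1 ∧ v (0, 0) = a ∧ (∀ i, i ≠ 0 → v (i, 0) = 0) ∧
      M ≤ (Finset.univ.filter fun y => v y = a).card := by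
  classical
  obtain ⟨T, hT, hTcard⟩ : ∃ T ⊆ (Finset.univ : Finset (Fin m)).erase 0, T.card = M - 1 := by
    refine Finset.exists_subset_card_eq ?_
    rw [Finset.card_erase_of_mem (Finset.mem_univ _), Finset.card_univ, Fintype.card_fin]
    omega
  have h0T : (0 : Fin m) ∉ T := fun h => by simpa using hT h
  refine ⟨fun y => if y.2 = 0 then (if y.1 = 0 then a else 0)
    else if y.1 ∈ T then a else if y.1 = 0 then Real.sqrt (1 - M * a ^ 2) else 0, ?_, ?_, ?_, ?_⟩
  · have hs : Real.sqrt (1 - M * a ^ 2) ^ 2 = 1 - M * a ^ 2 := Real.sq_sqrt (by linarith)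
    rw [Fintype.sum_prod_type_right, Fin.sum_univ_two]
    have h1 : ∀ i : Fin m, (if i ∈ T then a else if i = 0 then Real.sqrt (1 - M * a ^ 2) else 0) ^ 2
        = (if i ∈ T then a ^ 2 else 0) + if i = 0 then 1 - M * a ^ 2 else 0 := by
      intro i
      by_cases hi : i ∈ T
      · have : i ≠ 0 := by
          rintro rfl
          exact h0T hi
        simp [hi, this]
      · by_cases hi0 : i = 0
        · simp [hi0, h0T, hs]
        · simp [hi, hi0]
    simp only [if_true, Fin.isValue, one_ne_zero, if_false, h1, Finset.sum_add_distrib]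
    simp [ite_pow, hTcard, Nat.cast_sub hM1]
    ring
  · simp
  · intro i hi
    simp [hi]
  · have h : insert ((0 : Fin m), (0 : Fin 2)) (T ×ˢ {1}) ⊆
        Finset.univ.filter fun y : Reg m => (if y.2 = 0 then (if y.1 = 0 then a else 0)
          else if y.1 ∈ T then a else if y.1 = 0 then Real.sqrt (1 - M * a ^ 2) else 0) = a := by
      intro y hy
      rcases y with ⟨i, f⟩
      simp only [Finset.mem_insert, Finset.mem_product, Finset.mem_singleton, Prod.mk.injEq] at hy
      rcases hy with ⟨rfl, rfl⟩ | ⟨hi, rfl⟩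
      · simp
      · simp [hi]
    refine le_trans ?_ (Finset.card_le_card h)
    rw [Finset.card_insert_of_notMem (by simp), Finset.card_product, hTcard]
    simp
    omega

theorem card_filter_zero_ge {m : ℕ} [NeZero m] {v : Reg m → ℝ} (hv : ∀ i, i ≠ 0 → v (i, 0) = 0) :
    m - 1 ≤ (Finset.univ.filter fun y => v y = 0).card := by
  have h : ((Finset.univ : Finset (Fin m)).erase 0) ×ˢ ({0} : Finset (Fin 2)) ⊆
      Finset.univ.filter fun y => v y = 0 := by
    rintro ⟨i, f⟩ hy
    simp only [Finset.mem_product, Finset.mem_erase, Finset.mem_univ, and_true,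
      Finset.mem_singleton] at hy
    obtain ⟨hi, rfl⟩ := hy
    simpa using hv i hi
  refine le_trans ?_ (Finset.card_le_card h)
  simp [Finset.card_erase_of_mem]

/-- The hard instance with good state `|i₁⟩` up to a phase: the rows of `F` are permuted by `π`, the
rows `(0, 0)` and `(i₁, 0)` are exchanged, and the outputs get the phases given by `z`. -/
theorem isInstance_hard {m : ℕ} [NeZero m] {L : ℕ} [NeZero L] {F : Matrix (Reg m) (Reg m) ℂ}
    (hF : F ∈ Matrix.unitaryGroup (Reg m) ℂ) {v : Reg m → ℝ} (hFv : ∀ y, F y (0, 0) = v y) {a : ℝ}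
    (ha0 : 0 ≤ a) (ha1 : a ≤ 1) (hv0 : v (0, 0) = a) (hv : ∀ i, i ≠ 0 → v (i, 0) = 0)
    (π : ColumnPerm v) (z : Reg m → ZMod L) (i₁ : Fin m) :
    IsInstance (Matrix.diagonal (fun y => ZMod.stdAddChar (z y)) *
        F.submatrix (π.1 * Equiv.swap (0, 0) (i₁, 0) : Equiv.Perm (Reg m)) id) a
      (Pi.single i₁ (ZMod.stdAddChar (z (i₁, 0)))) := by
  refine isInstance_of_column (mul_mem (diagonal_mem_unitaryGroup fun y => norm_stdAddChar _)
    (submatrix_perm_mem_unitaryGroup hF _)) ha0 ha1 ?_ fun i => ?_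
  · rw [IsPureState, Finset.sum_eq_single i₁]
    · simp
    · intro i _ hi
      simp [Pi.single_eq_of_ne hi]
    · simp
  · rw [Matrix.diagonal_mul, Matrix.submatrix_apply, id, hFv, Equiv.Perm.mul_apply, π.2]
    rcases eq_or_ne i i₁ with rfl | hi
    · rw [Equiv.swap_apply_right, hv0, Pi.single_eq_same, mul_comm]
    · rw [Pi.single_eq_of_ne hi, mul_zero]
      rcases eq_or_ne i 0 with rfl | hi0
      · rw [Equiv.swap_apply_left, hv i₁ (Ne.symm hi)]
        simp
      · rw [Equiv.swap_apply_of_ne_of_ne (by simpa using hi0) (by simpa using hi), hv i hi0]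
        simp

/-! ### The lower bound -/

theorem exists_block_size {m : ℕ} (hm : 2 ≤ m) {a : ℝ} (ha0 : 0 < a) (ha1 : a ≤ 1) :
    ∃ M : ℕ, 1 ≤ M ∧ M ≤ m ∧ M * a ^ 2 ≤ 1 ∧ min ((2 * m : ℕ) : ℝ) (1 / a ^ 2) ≤ 2 * M := by
  have ha2 : 0 < a ^ 2 := by positivity
  have h1 : 1 ≤ 1 / a ^ 2 := by
    rw [le_div_iff₀ ha2]
    nlinarith
  have hf1 : 1 ≤ ⌊1 / a ^ 2⌋₊ := Nat.one_le_floor_iff _ |>.2 h1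
  have hf : (⌊1 / a ^ 2⌋₊ : ℝ) ≤ 1 / a ^ 2 := Nat.floor_le (by positivity)
  refine ⟨min m ⌊1 / a ^ 2⌋₊, le_min (by omega) hf1, min_le_left _ _, ?_, ?_⟩
  · have h2 : ((min m ⌊1 / a ^ 2⌋₊ : ℕ) : ℝ) ≤ 1 / a ^ 2 :=
      le_trans (by exact_mod_cast min_le_right _ _) hf
    exact (le_div_iff₀ ha2).1 h2
  · rcases min_cases m ⌊1 / a ^ 2⌋₊ with ⟨h, _⟩ | ⟨h, _⟩
    · rw [h]
      refine (min_le_left _ _).trans ?_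
      push_cast
      rfl
    · rw [h]
      refine (min_le_right _ _).trans ?_
      have h3 := Nat.lt_floor_add_one (1 / a ^ 2)
      have h4 : (1 : ℝ) ≤ ⌊1 / a ^ 2⌋₊ := by exact_mod_cast hf1
      linarith

namespace ForwardAlgorithm

variable {m : ℕ} [NeZero m] {A : ForwardAlgorithm m} {L : ℕ} [NeZero L] {r : ℕ}
  {u : Fin r → Reg m × Fin (A.work 0) → ℂ}

/-- In the sector that avoids the rows of the two possible good states the algorithm behaves in the
same way for both, so an algorithm that is correct for both halts there with small weight only. -/
theorem sum_haltWeight_le (hu : A.init = ∑ l, Matrix.vecMulVec (u l) (star (u l)))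
    {F : Matrix (Reg m) (Reg m) ℂ}
    (hF : F ∈ Matrix.unitaryGroup (Reg m) ℂ) {v : Reg m → ℝ} (hFv : ∀ y, F y (0, 0) = v y) {a : ℝ}
    (ha0 : 0 ≤ a) (ha1 : a ≤ 1) (hv0 : v (0, 0) = a) (hv : ∀ i, i ≠ 0 → v (i, 0) = 0)
    (hA : A.SolvesOn a a) (π : ColumnPerm v) {n : ℕ} (hn : n ≤ L) {i₁ : Fin m} (hi₁ : i₁ ≠ 0) :
    ∑ k ∈ Finset.range n, ∑ i,
      A.haltWeight L (F.submatrix π.1 id) u (0, 0) (i₁, 0) k i ≤ 0.04 := by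
  set w : ℕ → Fin m → ℝ := fun k i =>
    A.haltWeight L (F.submatrix π.1 id) u (0, 0) (i₁, 0) k i with hw
  have hw0 : ∀ k i, 0 ≤ w k i := fun k i => by
    simp only [hw, haltWeight]
    positivity
  have hZ : (0 : ℝ) < Fintype.card (Reg m → ZMod L) := by exact_mod_cast Fintype.card_pos
  have key : ∀ i₂ : Fin m, i₂ = 0 ∨ i₂ = i₁ →
      ∑ k ∈ Finset.range n, ∑ i ∈ Finset.univ.erase i₂, w k i ≤ 0.02 := by
    intro i₂ hi₂
    set V := F.submatrix (π.1 * Equiv.swap (0, 0) (i₂, 0) : Equiv.Perm (Reg m)) id with hV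
    have hrow : ∀ y, y ≠ (0, 0) → y ≠ (i₁, 0) → F.submatrix π.1 id y = V y := by
      intro y hy hy'
      have hy2 : y ≠ (i₂, 0) := by
        rcases hi₂ with rfl | rfl
        exacts [hy, hy']
      ext x
      simp [hV, Equiv.swap_apply_of_ne_of_ne hy hy2]
    have h1 : ∀ z : Reg m → ZMod L, ∑ k ∈ Finset.range n, ∑ i ∈ Finset.univ.erase i₂,
        (A.outputAt (Matrix.diagonal (fun y => ZMod.stdAddChar (z y)) * V) k i i).re ≤ 0.02 := by
      intro z
      have hI := isInstance_hard hF hFv ha0 ha1 hv0 hv π z i₂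
      obtain ⟨ρ, hρ, hd⟩ := hA _ a _ hI le_rfl le_rfl
      exact sum_outputAt_off_le hI.1 hρ (by simp) hd n
    have h2 : Fintype.card (Reg m → ZMod L) *
        ∑ k ∈ Finset.range n, ∑ i ∈ Finset.univ.erase i₂, w k i ≤
        ∑ z : Reg m → ZMod L, ∑ k ∈ Finset.range n, ∑ i ∈ Finset.univ.erase i₂,
          (A.outputAt (Matrix.diagonal (fun y => ZMod.stdAddChar (z y)) * V) k i i).re := by
      rw [Finset.sum_comm (s := (Finset.univ : Finset (Reg m → ZMod L))), Finset.mul_sum]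
      refine Finset.sum_le_sum fun k hk => ?_
      rw [Finset.sum_comm (s := (Finset.univ : Finset (Reg m → ZMod L))), Finset.mul_sum]
      refine Finset.sum_le_sum fun i _ => ?_
      have hkL : k < L := by
        have := Finset.mem_range.1 hk
        omega
      simp only [hw]
      rw [haltWeight_congr hkL hrow]
      exact card_mul_haltWeight_le hu _ _ k i
    have h3 : ∑ z : Reg m → ZMod L, ∑ k ∈ Finset.range n, ∑ i ∈ Finset.univ.erase i₂,
          (A.outputAt (Matrix.diagonal (fun y => ZMod.stdAddChar (z y)) * V) k i i).re ≤
        Fintype.card (Reg m → ZMod L) * 0.02 := by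
      refine (Finset.sum_le_sum fun z _ => h1 z).trans_eq ?_
      rw [Finset.sum_const, Finset.card_univ, nsmul_eq_mul]
    exact le_of_mul_le_mul_left (h2.trans h3) hZ
  have hsplit : ∑ k ∈ Finset.range n, ∑ i, w k i ≤
      ∑ k ∈ Finset.range n, ∑ i ∈ Finset.univ.erase 0, w k i +
        ∑ k ∈ Finset.range n, ∑ i ∈ Finset.univ.erase i₁, w k i := by
    rw [← Finset.sum_add_distrib]
    refine Finset.sum_le_sum fun k _ => ?_
    have h4 := Finset.sum_erase_add Finset.univ (w k) (Finset.mem_univ 0)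
    have h5 : w k 0 ≤ ∑ i ∈ Finset.univ.erase i₁, w k i :=
      Finset.single_le_sum (fun i _ => hw0 k i) (Finset.mem_erase.2 ⟨hi₁.symm, Finset.mem_univ 0⟩)
    linarith
  have := key 0 (Or.inl rfl)
  have := key i₁ (Or.inr rfl)
  linarith

end ForwardAlgorithm

end AmpAmp

open AmpAmp AmpAmp.ForwardAlgorithm in
theorem theorem1p3 :
    ∃ c K : ℝ, 0 < c ∧ 1 ≤ K ∧
      ∀ (m : ℕ) [NeZero m], 2 ≤ m →
        ∀ aStar : ℝ, 0 < aStar → aStar ≤ 1 →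
          ∀ A : AmpAmp.ForwardAlgorithm m, A.SolvesOn aStar (K * aStar) →
            ∃ (X : Matrix (AmpAmp.Reg m) (AmpAmp.Reg m) ℂ) (a : ℝ) (φ : Fin m → ℂ),
              AmpAmp.IsInstance X a φ ∧ aStar ≤ a ∧ a ≤ K * aStar ∧
                ENNReal.ofReal (c * min ((2 * m : ℕ) : ℝ) (1 / aStar ^ 2)) ≤
                  A.expectedQueries X := by
  refine ⟨1 / 64, 1, by norm_num, le_rfl, fun m _ hm a ha0 ha1 A hA => ?_⟩
  rw [one_mul] at hA ⊢
  by_contra! hcon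
  obtain ⟨M, hM1, hMm, hMa, hmin⟩ := exists_block_size hm ha0 ha1
  obtain ⟨v, hvnorm, hv0, hv, hvcard⟩ := exists_column hM1 hMm hMa
  obtain ⟨F, hF, hFv⟩ := exists_unitary_column (fun y => (v y : ℂ)) (by simpa using hvnorm)
    ((0, 0) : Reg m)
  obtain ⟨r, u, hu⟩ := A.exists_init_eq_sum
  set i₁ : Fin m := ⟨1, by omega⟩ with hi₁
  have hi₁0 : i₁ ≠ 0 := by
    intro h
    have := congrArg Fin.val h
    simp [hi₁] at this
  -- With a cutoff `n ≤ M / 8` the hits have weight at most `2 / 7`; since `M ≤ 8 * (n + 1)`, Markov's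
  -- inequality bounds the weight of the runs that go on by `1 / 4`; and `L > n` keeps the counts from
  -- wrapping around.
  set n : ℕ := M / 8 with hn
  set L : ℕ := n + 2 with hL
  have hX : ∀ (π : ColumnPerm v) (z : Reg m → ZMod L),
      IsInstance (Matrix.diagonal (fun y => ZMod.stdAddChar (z y)) * F.submatrix π.1 id) a
        (Pi.single 0 (ZMod.stdAddChar (z (0, 0)))) := by
    intro π z
    have := isInstance_hard hF hFv ha0.le ha1 hv0 hv π z 0
    rwa [Equiv.swap_self, ← Equiv.Perm.one_def, mul_one] at this
  have hnM : (M : ℝ) ≤ 8 * (n + 1) := by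
    have : M ≤ 8 * (n + 1) := by omega
    exact_mod_cast this
  have hMn : 8 * (n : ℝ) ≤ M := by
    have : 8 * n ≤ M := by omega
    exact_mod_cast this
  set cont : ColumnPerm v → ℕ → ℝ := fun π k =>
    A.contWeight L (F.submatrix π.1 id) u (0, 0) (i₁, 0) k with hcont
  set hit : ColumnPerm v → ℕ → Reg m → ℝ := fun π k y =>
    A.hitWeight L (F.submatrix π.1 id) u (0, 0) (i₁, 0) k y with hhit
  have hcont1 : ∀ π k, cont π k ≤ 1 := fun π k =>
    contWeight_le_of_forall hu (fun z => (hX π z).1) _ _ k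
      fun z => trace_stateAt_le_one (hX π z).1 _
  have hcontn : ∀ π, cont π n ≤ 1 / 4 := fun π =>
    contWeight_le_of_forall hu (fun z => (hX π z).1) _ _ n fun z => by
      have h := mul_trace_stateAt_le_of_expectedQueries_lt (hX π z).1 n
        (hcon _ a _ (hX π z) le_rfl le_rfl)
      have hpos : (0 : ℝ) < n + 1 := by positivity
      refine le_of_mul_le_mul_left (h.trans ?_) hpos
      linarith
  set W : ℝ := ((Fintype.card (ColumnPerm v) : ℕ) : ℝ) with hW
  have hW0 : 0 < W := by
    have : Nonempty (ColumnPerm v) := ⟨⟨1, fun _ => rfl⟩⟩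
    rw [hW]
    exact_mod_cast Fintype.card_pos
  have hhits : ∀ k ∈ Finset.range n, ∀ y : Reg m, y = (0, 0) ∨ y = (i₁, 0) →
      7 * (n : ℝ) * ∑ π, hit π k y ≤ W := by
    intro k hk y hy
    have hkn : k + 1 ≤ n := Finset.mem_range.1 hk
    have hkn' : (k : ℝ) + 1 ≤ n := by exact_mod_cast hkn
    -- `M` rows share the entry `a` of the row `(0, 0)`, and `m - 1` rows the entry `0` of `(1, 0)`.
    have hcard : M - 1 ≤ (Finset.univ.filter fun y' => v y' = v y).card := by
      rcases hy with rfl | rfl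
      · rw [hv0]
        omega
      · rw [hv i₁ hi₁0]
        exact (Nat.sub_le_sub_right hMm 1).trans (card_filter_zero_ge hv)
    have h1 := mul_sum_hitWeight_le (A := A) (u := u) hF (L := L) (k := k) (by omega) hy hcard
    have h2 : ∑ π, cont π k ≤ W := by
      refine (Finset.sum_le_sum fun π _ => hcont1 π k).trans_eq ?_
      simp [hW]
    have h3 : 0 ≤ ∑ π, hit π k y := Finset.sum_nonneg fun π _ => by
      simp only [hhit, hitWeight]
      positivity
    refine le_trans (mul_le_mul_of_nonneg_right ?_ h3) (h1.trans h2)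
    rw [Nat.cast_sub hM1, Nat.cast_one]
    linarith
  have hhitsum : ∑ k ∈ Finset.range n, ∑ π, (hit π k (0, 0) + hit π k (i₁, 0)) ≤ 2 / 7 * W := by
    rcases Nat.eq_zero_or_pos n with h0 | hpos
    · rw [h0]
      simpa using hW0.le
    · have hpos' : (0 : ℝ) < n := by exact_mod_cast hpos
      have h : ∀ k ∈ Finset.range n,
          ∑ π, (hit π k (0, 0) + hit π k (i₁, 0)) ≤ 2 / 7 * W / n := by
        intro k hk
        rw [Finset.sum_add_distrib, le_div_iff₀ hpos']
        have h1 := hhits k hk _ (Or.inl rfl)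
        have h2 := hhits k hk _ (Or.inr rfl)
        linarith
      refine (Finset.sum_le_sum h).trans_eq ?_
      rw [Finset.sum_const, Finset.card_range, nsmul_eq_mul, mul_div_cancel₀ _ hpos'.ne']
  have htotal : W ≤ 0.04 * W + 2 / 7 * W + 1 / 4 * W := by
    calc W = ∑ _π : ColumnPerm v, (1 : ℝ) := by simp [hW]
      _ ≤ ∑ π, (0.04 + ∑ k ∈ Finset.range n, (hit π k (0, 0) + hit π k (i₁, 0)) + 1 / 4) := by
          refine Finset.sum_le_sum fun π _ => ?_
          have h1 := one_le_sum_haltWeight_add (A := A) (L := L)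
            (submatrix_perm_mem_unitaryGroup hF π.1) hu (0, 0) (i₁, 0) n
          have h2 := sum_haltWeight_le (L := L) hu hF hFv ha0.le ha1 hv0 hv hA π
            (n := n + 1) (by omega) hi₁0
          have h3 := hcontn π
          simp only [hcont, hhit] at h3 ⊢
          linarith
      _ = 0.04 * W + ∑ k ∈ Finset.range n, ∑ π, (hit π k (0, 0) + hit π k (i₁, 0)) +
            1 / 4 * W := by
          rw [Finset.sum_add_distrib, Finset.sum_add_distrib, Finset.sum_comm]
          simp [hW]
          ring
      _ ≤ _ := by linarith
  linarith
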